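/- Let $L_1=L_1([0,1],\mu)$, where $\mu$ is Lebesgue measure, with real or complex scalars. A bounded linear operator $T\colon L_1\to L_1$ is called an atom if it maps disjoint functions to disjoint functions, that is, if for all $f,g\in L_1$, $\mu(\operatorname{supp} f\cap\operatorname{supp} g)=0$ implies $\mu(\operatorname{supp} Tf\cap\operatorname{supp} Tg)=0$, where $\operatorname{supp} f=\{t: f(t)\neq 0\}$ (defined up to null sets). For subspaces $X,Y$ of $L_1$ let $d(X,Y)=\inf\{\|x-y\| : x\in X,\ \|x\|=1,\ y\in Y\}$. Let $T\colon L_1\to L_1$ be a nonzero atom such that $T\neq\lambda I$ for every scalar $\lambda$. Then there exists a closed subspace $Y\subseteq L_1$ such that $Y$ is linearly isometric to $L_1$, $d(Y,TY)>0$, and $Y+TY$ is complemented in $L_1$ (that is, $Y+TY$ is the range of a bounded linear projection on $L_1$). -/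

import Mathlib

open MeasureTheory

/-- Lebesgue measure on `[0,1]`, as a measure on `ℝ`. -/
noncomputable abbrev unitLebesgue : Measure ℝ :=
  (volume : Measure ℝ).restrict (Set.Icc (0 : ℝ) 1)

/-- The Banach space `L₁ = L₁([0,1], Lebesgue)` with scalar field `𝕜` (`ℝ` or `ℂ`). -/
abbrev LOne (𝕜 : Type) [RCLike 𝕜] : Type := Lp 𝕜 1 unitLebesgue

/-- An operator on `L₁` is an atom if it maps disjoint functions to disjoint functions, where
`f` and `g` are disjoint if their supports meet in a null set only. -/
def IsAtomOperator {𝕜 : Type} [RCLike 𝕜] (T : LOne 𝕜 →L[𝕜] LOne 𝕜) : Prop :=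
  ∀ f g : LOne 𝕜,
    unitLebesgue (Function.support (f : ℝ → 𝕜) ∩ Function.support (g : ℝ → 𝕜)) = 0 →
    unitLebesgue (Function.support (T f : ℝ → 𝕜) ∩ Function.support (T g : ℝ → 𝕜)) = 0

/-- `d(X, Y) = inf {‖x - y‖ : x ∈ S_X, y ∈ Y}`, where `S_X` is the unit sphere of `X`. -/
noncomputable def subspaceDist {𝕜 E : Type} [RCLike 𝕜] [NormedAddCommGroup E] [NormedSpace 𝕜 E]
    (X Y : Submodule 𝕜 E) : ℝ :=
  sInf {r : ℝ | ∃ x ∈ X, ‖x‖ = 1 ∧ ∃ y ∈ Y, r = ‖x - y‖}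

/-! Let Y be the range of an isometric embedding U of L₁. It suffices to find bounded V, W with VU =
I, WU = 0 and WTU = I: on Y + TY, W reads off the TY component and V then recovers the Y component,
and boundedness yields both the gap and the projection (`exists_subspace_of_leftInverse`).

Suppose S = P_{Aᶜ} T P_A ≠ 0 for some band projection P_A. Since S preserves disjointness and the L₁
norm is additive on disjoint functions, C ↦ ‖S 1_C‖ is an absolutely continuous measure, so it
dominates a multiple of Lebesgue measure on some B of positive measure
(`PreservesDisjoint.exists_boundedBelow`). Hence S is bounded below on L₁(B), which contains a copy
U of L₁. A conditional expectation gives SU a left inverse (`PreservesDisjoint.exists_leftInverse`);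
composed with P_{Aᶜ} it is the required W, because U maps into L₁(A).

Otherwise T commutes with every band projection, so it is multiplication by h = T1, which is not
constant. Choose disjoint sets on which h is close to distinct values a and b, embed L₁ in each, and
let U be half the sum. The difference of the two recovery maps kills U and sends TUf to nearly (a -
b)f; a Neumann series corrects the error. -/

open scoped ENNReal NNReal Topology

/-! ### Disjointness and band projections. -/

section Bands

variable {α : Type*} [MeasurableSpace α] {μ : Measure α} {𝕜 : Type*} [RCLike 𝕜]

/-- Two elements of `L₁` are disjoint if almost everywhere one of them vanishes. -/
def AEDisjointFun (f g : Lp 𝕜 1 μ) : Prop := ∀ᵐ x ∂μ, f x = 0 ∨ g x = 0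

/-- A bounded operator between `L₁`-spaces which preserves disjointness. -/
def PreservesDisjoint {β : Type*} [MeasurableSpace β] {ν : Measure β}
    (T : Lp 𝕜 1 μ →L[𝕜] Lp 𝕜 1 ν) : Prop :=
  ∀ f g : Lp 𝕜 1 μ, AEDisjointFun f g → AEDisjointFun (T f) (T g)

theorem AEDisjointFun.symm {f g : Lp 𝕜 1 μ} (h : AEDisjointFun f g) : AEDisjointFun g f := by
  filter_upwards [h] with x hx using hx.symm

theorem aeDisjointFun_iff_measure_support_inter (f g : Lp 𝕜 1 μ) :
    AEDisjointFun f g ↔ μ (Function.support f ∩ Function.support g) = 0 := by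
  rw [AEDisjointFun, ae_iff]
  simp only [not_or]
  rfl

theorem AEDisjointFun.norm_add {f g : Lp 𝕜 1 μ} (h : AEDisjointFun f g) :
    ‖f + g‖ = ‖f‖ + ‖g‖ := by
  rw [L1.norm_eq_integral_norm, L1.norm_eq_integral_norm, L1.norm_eq_integral_norm,
    ← integral_add (L1.integrable_coeFn f).norm (L1.integrable_coeFn g).norm]
  refine integral_congr_ae ?_
  filter_upwards [h, Lp.coeFn_add f g] with x hx hadd
  rw [hadd, Pi.add_apply]
  rcases hx with hx | hx <;> simp [hx]

/-- Multiplication by the indicator function of a measurable set, as an operator on `L₁`. -/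
noncomputable def bandProj {A : Set α} (hA : MeasurableSet A) : Lp 𝕜 1 μ →L[𝕜] Lp 𝕜 1 μ :=
  LinearMap.mkContinuous
    { toFun := fun f => ((Lp.memLp f).indicator hA).toLp (A.indicator f)
      map_add' := by
        intro f g
        rw [← MemLp.toLp_add, MemLp.toLp_eq_toLp_iff]
        filter_upwards [Lp.coeFn_add f g] with x hx
        by_cases hxA : x ∈ A
        · rw [Set.indicator_of_mem hxA, Pi.add_apply, Set.indicator_of_mem hxA,
            Set.indicator_of_mem hxA, hx, Pi.add_apply]
        · simp [hxA]
      map_smul' := by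
        intro c f
        rw [RingHom.id_apply, ← MemLp.toLp_const_smul, MemLp.toLp_eq_toLp_iff]
        filter_upwards [Lp.coeFn_smul c f] with x hx
        by_cases hxA : x ∈ A <;> simp [hxA, hx] } 1 (by
    intro f
    rw [one_mul]
    refine Lp.norm_le_norm_of_ae_le ?_
    simp only [LinearMap.coe_mk, AddHom.coe_mk]
    filter_upwards [((Lp.memLp f).indicator hA).coeFn_toLp] with x hx
    rw [hx]
    exact norm_indicator_le_norm_self _ _)

theorem coeFn_bandProj {A : Set α} (hA : MeasurableSet A) (f : Lp 𝕜 1 μ) :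
    bandProj hA f =ᵐ[μ] A.indicator f :=
  ((Lp.memLp f).indicator hA).coeFn_toLp

theorem norm_bandProj_le {A : Set α} (hA : MeasurableSet A) (f : Lp 𝕜 1 μ) :
    ‖bandProj hA f‖ ≤ ‖f‖ := by
  refine Lp.norm_le_norm_of_ae_le ?_
  filter_upwards [coeFn_bandProj hA f] with x hx
  rw [hx]
  exact norm_indicator_le_norm_self _ _

theorem bandProj_eq_self_iff {A : Set α} (hA : MeasurableSet A) (f : Lp 𝕜 1 μ) :
    bandProj hA f = f ↔ ∀ᵐ x ∂μ, x ∉ A → f x = 0 := by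
  rw [Lp.ext_iff]
  constructor <;> intro h
  · filter_upwards [h, coeFn_bandProj hA f] with x h1 h2 hx
    rw [← h1, h2, Set.indicator_of_notMem hx]
  · filter_upwards [h, coeFn_bandProj hA f] with x h1 h2
    rw [h2]
    by_cases hx : x ∈ A
    · rw [Set.indicator_of_mem hx]
    · rw [Set.indicator_of_notMem hx, h1 hx]

theorem bandProj_eq_zero_iff {A : Set α} (hA : MeasurableSet A) (f : Lp 𝕜 1 μ) :
    bandProj hA f = 0 ↔ ∀ᵐ x ∂μ, x ∈ A → f x = 0 := by
  rw [Lp.eq_zero_iff_ae_eq_zero]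
  constructor <;> intro h
  · filter_upwards [h, coeFn_bandProj hA f] with x h1 h2 hx
    rw [h2, Set.indicator_of_mem hx] at h1
    exact h1
  · filter_upwards [h, coeFn_bandProj hA f] with x h1 h2
    rw [h2]
    by_cases hx : x ∈ A
    · rw [Set.indicator_of_mem hx, h1 hx]; rfl
    · rw [Set.indicator_of_notMem hx]; rfl

theorem bandProj_bandProj {A B : Set α} (hA : MeasurableSet A) (hB : MeasurableSet B)
    (f : Lp 𝕜 1 μ) : bandProj hA (bandProj hB f) = bandProj (hA.inter hB) f := by
  rw [Lp.ext_iff]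
  filter_upwards [coeFn_bandProj hA (bandProj hB f), coeFn_bandProj hB f,
    coeFn_bandProj (hA.inter hB) f] with x h1 h2 h3
  rw [h1, h3, ← Set.indicator_indicator]
  by_cases hx : x ∈ A
  · rw [Set.indicator_of_mem hx, Set.indicator_of_mem hx, h2]
  · rw [Set.indicator_of_notMem hx, Set.indicator_of_notMem hx]

theorem bandProj_self {A : Set α} (hA : MeasurableSet A) (f : Lp 𝕜 1 μ) :
    bandProj hA (bandProj hA f) = bandProj hA f := by
  rw [bandProj_bandProj]
  simp only [Set.inter_self]

theorem bandProj_comm {A B : Set α} (hA : MeasurableSet A) (hB : MeasurableSet B)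
    (f : Lp 𝕜 1 μ) : bandProj hA (bandProj hB f) = bandProj hB (bandProj hA f) := by
  rw [bandProj_bandProj, bandProj_bandProj]
  congr 1
  simp only [Set.inter_comm]

theorem bandProj_add_compl {A : Set α} (hA : MeasurableSet A) (f : Lp 𝕜 1 μ) :
    bandProj hA f + bandProj hA.compl f = f := by
  rw [Lp.ext_iff]
  filter_upwards [coeFn_bandProj hA f, coeFn_bandProj hA.compl f,
    Lp.coeFn_add (bandProj hA f) (bandProj hA.compl f)] with x h1 h2 h3
  rw [h3, Pi.add_apply, h1, h2]
  by_cases hx : x ∈ A <;> simp [hx]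

theorem bandProj_compl {A : Set α} (hA : MeasurableSet A) (f : Lp 𝕜 1 μ) :
    bandProj hA.compl f = f - bandProj hA f := by
  rw [eq_sub_iff_add_eq', bandProj_add_compl]

theorem bandProj_compl_bandProj {A : Set α} (hA : MeasurableSet A) (f : Lp 𝕜 1 μ) :
    bandProj hA.compl (bandProj hA f) = 0 := by
  rw [bandProj_compl hA, bandProj_self, sub_self]

theorem bandProj_bandProj_compl {A : Set α} (hA : MeasurableSet A) (f : Lp 𝕜 1 μ) :
    bandProj hA (bandProj hA.compl f) = 0 := by
  rw [bandProj_comm hA hA.compl, bandProj_compl_bandProj]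

theorem bandProj_bandProj_of_disjoint {A B : Set α} (hA : MeasurableSet A) (hB : MeasurableSet B)
    (hAB : Disjoint A B) (f : Lp 𝕜 1 μ) : bandProj hA (bandProj hB f) = 0 := by
  rw [bandProj_bandProj, bandProj_eq_zero_iff]
  filter_upwards with x hx
  exact absurd hx.2 (Set.disjoint_left.1 hAB hx.1)

theorem aeDisjointFun_bandProj {A B : Set α} (hA : MeasurableSet A) (hB : MeasurableSet B)
    (hAB : Disjoint A B) (f g : Lp 𝕜 1 μ) :
    AEDisjointFun (bandProj hA f) (bandProj hB g) := by
  filter_upwards [coeFn_bandProj hA f, coeFn_bandProj hB g] with x h1 h2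
  rw [h1, h2]
  by_cases hx : x ∈ A
  · exact Or.inr (Set.indicator_of_notMem (Set.disjoint_left.1 hAB hx) _)
  · exact Or.inl (Set.indicator_of_notMem hx _)

theorem AEDisjointFun.bandProj_left {A : Set α} (hA : MeasurableSet A) {f g : Lp 𝕜 1 μ}
    (h : AEDisjointFun f g) : AEDisjointFun (bandProj hA f) g := by
  filter_upwards [coeFn_bandProj hA f, h] with x h1 h2
  rw [h1]
  refine h2.imp_left fun h => ?_
  by_cases hx : x ∈ A <;> simp [hx, h]

theorem AEDisjointFun.bandProj_right {A : Set α} (hA : MeasurableSet A) {f g : Lp 𝕜 1 μ}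
    (h : AEDisjointFun f g) : AEDisjointFun f (bandProj hA g) :=
  (h.symm.bandProj_left hA).symm

theorem preservesDisjoint_bandProj {A : Set α} (hA : MeasurableSet A) :
    PreservesDisjoint (bandProj hA : Lp 𝕜 1 μ →L[𝕜] Lp 𝕜 1 μ) :=
  fun _ _ h => (h.bandProj_left hA).bandProj_right hA

theorem PreservesDisjoint.comp {β γ : Type*} [MeasurableSpace β] [MeasurableSpace γ]
    {ν : Measure β} {ρ : Measure γ} {S : Lp 𝕜 1 ν →L[𝕜] Lp 𝕜 1 ρ}
    {T : Lp 𝕜 1 μ →L[𝕜] Lp 𝕜 1 ν} (hS : PreservesDisjoint S) (hT : PreservesDisjoint T) :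
    PreservesDisjoint (S ∘L T) :=
  fun f g h => hS _ _ (hT f g h)

theorem bandProj_union {A B : Set α} (hA : MeasurableSet A) (hB : MeasurableSet B)
    (f : Lp 𝕜 1 μ) :
    bandProj (hA.union hB) f = bandProj hA f + bandProj hB f - bandProj hA (bandProj hB f) := by
  have h1 : bandProj hA (bandProj (hA.union hB) f) = bandProj hA f := by
    rw [bandProj_bandProj]
    simp only [Set.inter_union_distrib_left, Set.inter_self, Set.union_eq_self_of_subset_right,
      Set.inter_subset_left]
  have h2 : bandProj hA.compl (bandProj (hA.union hB) f) = bandProj hA.compl (bandProj hB f) := by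
    rw [bandProj_bandProj, bandProj_bandProj]
    simp only [Set.inter_union_distrib_left, Set.compl_inter_self, Set.empty_union]
  rw [← bandProj_add_compl hA (bandProj (hA.union hB) f), h1, h2, bandProj_compl hA]
  abel

end Bands

/-! ### Reduction to indicator functions; monotone limits of bands. -/

section Indicators

variable {α : Type*} [MeasurableSpace α] {μ : Measure α} [IsFiniteMeasure μ]
  {𝕜 : Type*} [RCLike 𝕜]

variable (𝕜 μ) in
/-- The indicator function of a measurable set, as an element of `L₁`. -/
noncomputable def indOne {A : Set α} (hA : MeasurableSet A) : Lp 𝕜 1 μ :=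
  indicatorConstLp 1 hA (measure_ne_top μ A) (1 : 𝕜)

theorem coeFn_indOne {A : Set α} (hA : MeasurableSet A) :
    indOne μ 𝕜 hA =ᵐ[μ] A.indicator fun _ => (1 : 𝕜) :=
  indicatorConstLp_coeFn

theorem norm_indOne {A : Set α} (hA : MeasurableSet A) : ‖indOne μ 𝕜 hA‖ = μ.real A := by
  rw [indOne, norm_indicatorConstLp one_ne_zero ENNReal.one_ne_top]
  simp

theorem bandProj_indOne {A B : Set α} (hA : MeasurableSet A) (hB : MeasurableSet B) :
    bandProj hA (indOne μ 𝕜 hB) = indOne μ 𝕜 (hA.inter hB) := by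
  rw [Lp.ext_iff]
  filter_upwards [coeFn_bandProj hA (indOne μ 𝕜 hB), coeFn_indOne (μ := μ) (𝕜 := 𝕜) hB,
    coeFn_indOne (μ := μ) (𝕜 := 𝕜) (hA.inter hB)] with x h1 h2 h3
  rw [h1, h3, ← Set.indicator_indicator]
  by_cases hx : x ∈ A
  · rw [Set.indicator_of_mem hx, Set.indicator_of_mem hx, h2]
  · rw [Set.indicator_of_notMem hx, Set.indicator_of_notMem hx]

theorem bandProj_indOne_univ {A : Set α} (hA : MeasurableSet A) :
    bandProj hA (indOne μ 𝕜 MeasurableSet.univ) = indOne μ 𝕜 hA := by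
  rw [bandProj_indOne]
  congr 1
  simp

theorem indicatorConst_eq_smul_indOne (c : 𝕜) {s : Set α} (hs : MeasurableSet s)
    (hμs : μ s ≠ ∞) :
    (Lp.simpleFunc.indicatorConst 1 hs hμs c : Lp 𝕜 1 μ) = c • indOne μ 𝕜 hs := by
  rw [Lp.simpleFunc.coe_indicatorConst, Lp.ext_iff]
  filter_upwards [indicatorConstLp_coeFn (p := 1) (hs := hs) (hμs := hμs) (c := c),
    Lp.coeFn_smul c (indOne μ 𝕜 hs), coeFn_indOne (μ := μ) (𝕜 := 𝕜) hs] with x h1 h2 h3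
  rw [h1, h2, Pi.smul_apply, h3]
  by_cases hx : x ∈ s <;> simp [hx]

/-- Induction principle for `L₁` of a finite measure with scalar values. -/
theorem lOne_induction (P : Lp 𝕜 1 μ → Prop)
    (ind : ∀ (c : 𝕜) (A : Set α) (hA : MeasurableSet A), P (c • indOne μ 𝕜 hA))
    (add : ∀ f g : Lp 𝕜 1 μ, AEDisjointFun f g → P f → P g → P (f + g))
    (closed : IsClosed {f | P f}) (f : Lp 𝕜 1 μ) : P f := by
  refine Lp.induction ENNReal.one_ne_top P ?_ ?_ closed f
  · intro c s hs hμs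
    rw [indicatorConst_eq_smul_indOne]
    exact ind c s hs
  · intro f g hf hg hfg
    refine add _ _ ?_
    filter_upwards [hf.coeFn_toLp, hg.coeFn_toLp] with x h1 h2
    rw [h1, h2]
    by_contra! h
    exact Set.disjoint_left.1 hfg h.1 h.2

theorem clm_ext_indOne {E : Type*} [NormedAddCommGroup E] [NormedSpace 𝕜 E]
    {S T : Lp 𝕜 1 μ →L[𝕜] E}
    (h : ∀ (A : Set α) (hA : MeasurableSet A), S (indOne μ 𝕜 hA) = T (indOne μ 𝕜 hA)) :
    S = T := by
  ext1 f
  refine lOne_induction (fun f => S f = T f) ?_ ?_ ?_ f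
  · intro c A hA
    rw [map_smul, map_smul, h]
  · intro f g _ hf hg
    rw [map_add, map_add, hf, hg]
  · exact isClosed_eq S.continuous T.continuous

theorem norm_le_of_norm_indOne_le {E : Type*} [NormedAddCommGroup E] [NormedSpace 𝕜 E]
    {S : Lp 𝕜 1 μ →L[𝕜] E} {ε : ℝ}
    (h : ∀ (A : Set α) (hA : MeasurableSet A), ‖S (indOne μ 𝕜 hA)‖ ≤ ε * μ.real A)
    (f : Lp 𝕜 1 μ) : ‖S f‖ ≤ ε * ‖f‖ := by
  refine lOne_induction (fun f => ‖S f‖ ≤ ε * ‖f‖) ?_ ?_ ?_ f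
  · intro c A hA
    rw [map_smul, norm_smul, norm_smul, norm_indOne, mul_left_comm]
    exact mul_le_mul_of_nonneg_left (h A hA) (norm_nonneg c)
  · intro f g hfg hf hg
    rw [map_add, hfg.norm_add, mul_add]
    exact (norm_add_le _ _).trans (add_le_add hf hg)
  · exact isClosed_le S.continuous.norm (continuous_const.mul continuous_norm)

/-- Lower bounds do not usually pass to sums; here they do, because the norms of both the disjoint
summands and their images add exactly. -/
theorem PreservesDisjoint.le_norm_of_le_norm_indOne {β : Type*} [MeasurableSpace β]
    {ν : Measure β} {T : Lp 𝕜 1 μ →L[𝕜] Lp 𝕜 1 ν} (hT : PreservesDisjoint T) {δ : ℝ} {A : Set α}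
    (hA : MeasurableSet A)
    (h : ∀ (B : Set α) (hB : MeasurableSet B),
      δ * μ.real (A ∩ B) ≤ ‖T (indOne μ 𝕜 (hA.inter hB))‖)
    (f : Lp 𝕜 1 μ) : δ * ‖bandProj hA f‖ ≤ ‖T (bandProj hA f)‖ := by
  refine lOne_induction (fun f => δ * ‖bandProj hA f‖ ≤ ‖T (bandProj hA f)‖) ?_ ?_ ?_ f
  · intro c B hB
    rw [map_smul, map_smul, norm_smul, norm_smul, bandProj_indOne, norm_indOne, mul_left_comm]
    exact mul_le_mul_of_nonneg_left (h B hB) (norm_nonneg c)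
  · intro f g hfg hf hg
    have h1 := preservesDisjoint_bandProj hA f g hfg
    rw [map_add, map_add, h1.norm_add, (hT _ _ h1).norm_add, mul_add]
    exact add_le_add hf hg
  · exact isClosed_le (continuous_const.mul (bandProj hA).continuous.norm)
      (T.continuous.comp (bandProj hA).continuous).norm

/-- A disjointness preserving operator maps bands into bands. -/
theorem PreservesDisjoint.exists_bandProj_comm {β : Type*} [MeasurableSpace β]
    {ν : Measure β} {T : Lp 𝕜 1 μ →L[𝕜] Lp 𝕜 1 ν}
    (hT : PreservesDisjoint T) {A : Set α} (hA : MeasurableSet A) :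
    ∃ (E : Set β) (hE : MeasurableSet E), ∀ f, bandProj hE (T f) = T (bandProj hA f) := by
  -- The band in the target is the support of T1_A: it misses everything coming from Aᶜ by
  -- disjointness.
  have hE : MeasurableSet (Function.support (T (indOne μ 𝕜 hA))) :=
    (Lp.stronglyMeasurable _).measurableSet_support
  refine ⟨_, hE, ?_⟩
  have h1 (f : Lp 𝕜 1 μ) : bandProj hE (T (bandProj hA.compl f)) = 0 := by
    rw [bandProj_eq_zero_iff]
    have := hT (indOne μ 𝕜 hA) (bandProj hA.compl f) (by
      rw [← bandProj_indOne_univ hA]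
      exact aeDisjointFun_bandProj _ _ disjoint_compl_right _ _)
    filter_upwards [this] with x hx hxE
    exact hx.resolve_left hxE
  have h2 : bandProj hE ∘L T ∘L bandProj hA = T ∘L bandProj hA := by
    refine clm_ext_indOne fun B hB => ?_
    simp only [ContinuousLinearMap.comp_apply]
    rw [bandProj_eq_self_iff]
    -- T1_A is the sum of the disjoint functions T1_{A∩B} and T1_{A∖B}, so both vanish wherever it
    -- does.
    have h3 := hT (bandProj hB (indOne μ 𝕜 hA)) (bandProj hB.compl (indOne μ 𝕜 hA))
      (aeDisjointFun_bandProj _ _ disjoint_compl_right _ _)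
    have h4 : T (indOne μ 𝕜 hA) =
        T (bandProj hB (indOne μ 𝕜 hA)) + T (bandProj hB.compl (indOne μ 𝕜 hA)) := by
      rw [← map_add, bandProj_add_compl]
    have h5 : bandProj hA (indOne μ 𝕜 hB) = bandProj hB (indOne μ 𝕜 hA) := by
      rw [bandProj_indOne, bandProj_indOne]
      congr 1
      exact Set.inter_comm _ _
    rw [h5]
    have h6 := Lp.coeFn_add (T (bandProj hB (indOne μ 𝕜 hA)))
      (T (bandProj hB.compl (indOne μ 𝕜 hA)))
    rw [← h4] at h6
    filter_upwards [h3, h6] with x h7 h8 h9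
    rw [Function.notMem_support, h8, Pi.add_apply] at h9
    rcases h7 with h7 | h7
    · exact h7
    · rwa [h7, add_zero] at h9
  intro f
  have h3 := congrArg (fun S => S f) h2
  simp only [ContinuousLinearMap.comp_apply] at h3
  rw [← h3]
  conv_lhs => rw [← bandProj_add_compl hA f, map_add, map_add, h1, add_zero]

theorem tendsto_indOne_iUnion {A : ℕ → Set α} (hA : ∀ n, MeasurableSet (A n)) (hmono : Monotone A) :
    Filter.Tendsto (fun n => indOne μ 𝕜 (hA n)) Filter.atTop
      (𝓝 (indOne μ 𝕜 (MeasurableSet.iUnion hA))) := by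
  refine tendsto_indicatorConstLp_set ENNReal.one_ne_top ?_
  have h0 : ∀ n, μ (symmDiff (A n) (⋃ i, A i)) = μ ((⋃ i, A i) \ A n) := fun n => by
    rw [Set.symmDiff_def, Set.sdiff_eq_empty.2 (Set.subset_iUnion A n), Set.empty_union]
  simp_rw [h0]
  have := tendsto_measure_iInter_atTop (μ := μ) (s := fun n => (⋃ i, A i) \ A n)
    (fun n => ((MeasurableSet.iUnion hA).diff (hA n)).nullMeasurableSet)
    (fun i j hij => Set.sdiff_subset_sdiff_right (hmono hij)) ⟨0, measure_ne_top _ _⟩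
  rw [← Set.sdiff_iUnion, Set.sdiff_self, measure_empty] at this
  exact this

omit [IsFiniteMeasure μ] in
theorem norm_bandProj {A : Set α} (hA : MeasurableSet A) (f : Lp 𝕜 1 μ) :
    ‖bandProj hA f‖ = ∫ x in A, ‖f x‖ ∂μ := by
  rw [L1.norm_eq_integral_norm, ← integral_indicator hA]
  refine integral_congr_ae ?_
  filter_upwards [coeFn_bandProj hA f] with x hx
  rw [hx, norm_indicator_eq_indicator_norm]

omit [IsFiniteMeasure μ] in
theorem tendsto_bandProj_iUnion {A : ℕ → Set α} (hA : ∀ n, MeasurableSet (A n))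
    (hmono : Monotone A) (f : Lp 𝕜 1 μ) :
    Filter.Tendsto (fun n => bandProj (hA n) f) Filter.atTop
      (𝓝 (bandProj (MeasurableSet.iUnion hA) f)) := by
  rw [tendsto_iff_norm_sub_tendsto_zero]
  have h0 (n : ℕ) : ‖bandProj (hA n) f - bandProj (MeasurableSet.iUnion hA) f‖ =
      ∫ x in (⋃ i, A i) \ A n, ‖f x‖ ∂μ := by
    have h1 : bandProj (hA n) f = bandProj (hA n) (bandProj (MeasurableSet.iUnion hA) f) := by
      rw [bandProj_bandProj]
      congr 2
      simp only [Set.inter_eq_self_of_subset_left (Set.subset_iUnion A n)]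
    rw [h1, norm_sub_rev, ← bandProj_compl, bandProj_bandProj, norm_bandProj, Set.inter_comm]
    rfl
  simp_rw [h0]
  have h2 := tendsto_setIntegral_of_antitone (μ := μ) (f := fun x => ‖f x‖)
    (s := fun n => (⋃ i, A i) \ A n) (fun n => (MeasurableSet.iUnion hA).diff (hA n))
    (fun i j hij => Set.sdiff_subset_sdiff_right (hmono hij))
    ⟨0, (L1.integrable_coeFn f).norm.integrableOn⟩
  rw [← Set.sdiff_iUnion, Set.sdiff_self, Measure.restrict_empty, integral_zero_measure] at h2
  exact h2

end Indicators

/-! ### Left inverses of disjointness preserving embeddings, by conditional expectation. -/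

section LeftInverse

variable {α β : Type*} [MeasurableSpace α] [MeasurableSpace β] {ρ : Measure α} {μ : Measure β}
  {𝕜 : Type*} [RCLike 𝕜]

/-- The `σ`-algebra of all sets whose band projection corresponds under `T` to a band projection
in the domain of `T`. -/
@[reducible] def bandAlgebra (T : Lp 𝕜 1 ρ →L[𝕜] Lp 𝕜 1 μ) : MeasurableSpace β where
  MeasurableSet' E := ∃ (hE : MeasurableSet E) (A : Set α) (hA : MeasurableSet A),
    ∀ f, bandProj hE (T f) = T (bandProj hA f)
  measurableSet_empty := by
    refine ⟨MeasurableSet.empty, ∅, MeasurableSet.empty, fun f => ?_⟩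
    have h1 : bandProj MeasurableSet.empty (T f) = 0 := by
      rw [bandProj_eq_zero_iff]
      simp
    have h2 : bandProj MeasurableSet.empty f = 0 := by
      rw [bandProj_eq_zero_iff]
      simp
    rw [h1, h2, map_zero]
  measurableSet_compl := by
    rintro E ⟨hE, A, hA, h⟩
    refine ⟨hE.compl, Aᶜ, hA.compl, fun f => ?_⟩
    rw [bandProj_compl hE, bandProj_compl hA, map_sub, h]
  measurableSet_iUnion := by
    intro E hE
    choose hEm A hA h using hE
    -- Finite unions follow from the formula for P_{A∪B}; the countable union is their monotone
    -- limit.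
    have hEa (n : ℕ) : MeasurableSet (Set.accumulate E n) :=
      MeasurableSet.iUnion fun i => MeasurableSet.iUnion fun _ => hEm i
    have hAa (n : ℕ) : MeasurableSet (Set.accumulate A n) :=
      MeasurableSet.iUnion fun i => MeasurableSet.iUnion fun _ => hA i
    have hfin (n : ℕ) (f : Lp 𝕜 1 ρ) : bandProj (hEa n) (T f) = T (bandProj (hAa n) f) := by
      induction n generalizing f with
      | zero =>
        simp only [Set.accumulate_zero_nat]
        exact h 0 f
      | succ n ih =>
        simp only [Set.accumulate_succ]
        rw [bandProj_union (hEa n) (hEm (n + 1)), bandProj_union (hAa n) (hA (n + 1)),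
          map_sub, map_add, ih, h, ih]
    refine ⟨MeasurableSet.iUnion hEm, ⋃ n, A n, MeasurableSet.iUnion hA, fun f => ?_⟩
    have h1 := tendsto_bandProj_iUnion hEa Set.monotone_accumulate (T f)
    have h2 := (T.continuous.tendsto _).comp
      (tendsto_bandProj_iUnion hAa Set.monotone_accumulate f)
    simp only [Set.iUnion_accumulate] at h1 h2
    refine tendsto_nhds_unique h1 (h2.congr fun n => ?_)
    exact (hfin n f).symm

theorem bandAlgebra_le (T : Lp 𝕜 1 ρ →L[𝕜] Lp 𝕜 1 μ) : bandAlgebra T ≤ ‹MeasurableSpace β› :=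
  fun _ hE => hE.1

/-- The measure with density `|h|`. -/
noncomputable abbrev absDensity (h : Lp 𝕜 1 μ) : Measure β := μ.withDensity fun x => ‖h x‖ₑ

theorem measurable_enorm_lp (h : Lp 𝕜 1 μ) : Measurable fun x => ‖h x‖ₑ :=
  (Lp.stronglyMeasurable h).measurable.enorm

instance isFiniteMeasure_absDensity (h : Lp 𝕜 1 μ) : IsFiniteMeasure (absDensity h) :=
  isFiniteMeasure_withDensity (L1.integrable_coeFn h).2.ne

theorem ae_absDensity_iff (h : Lp 𝕜 1 μ) {p : β → Prop} :
    (∀ᵐ x ∂absDensity h, p x) ↔ ∀ᵐ x ∂μ, h x ≠ 0 → p x := by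
  rw [ae_withDensity_iff (measurable_enorm_lp h)]
  simp only [ne_eq, enorm_eq_zero]

theorem eLpNorm_mul_eq_absDensity (h : Lp 𝕜 1 μ) {k : β → 𝕜} (hk : StronglyMeasurable k) :
    eLpNorm (fun x => h x * k x) 1 μ = eLpNorm k 1 (absDensity h) := by
  rw [eLpNorm_one_eq_lintegral_enorm, eLpNorm_one_eq_lintegral_enorm,
    lintegral_withDensity_eq_lintegral_mul μ (measurable_enorm_lp h) hk.measurable.enorm]
  simp only [enorm_mul, Pi.mul_apply]

theorem memLp_mul_absDensity (h : Lp 𝕜 1 μ) (k : Lp 𝕜 1 (absDensity h)) :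
    MemLp (fun x => h x * k x) 1 μ := by
  refine ⟨((Lp.stronglyMeasurable h).mul (Lp.stronglyMeasurable k)).aestronglyMeasurable, ?_⟩
  rw [eLpNorm_mul_eq_absDensity h (Lp.stronglyMeasurable k)]
  exact (Lp.memLp k).2

/-- Multiplication by `h` as an isometry from `L₁(|h| dμ)` to `L₁(μ)`. -/
noncomputable def mulIsometry (h : Lp 𝕜 1 μ) : Lp 𝕜 1 (absDensity h) →ₗᵢ[𝕜] Lp 𝕜 1 μ where
  toFun k := (memLp_mul_absDensity h k).toLp _
  map_add' k l := by
    rw [← MemLp.toLp_add, MemLp.toLp_eq_toLp_iff]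
    filter_upwards [(ae_absDensity_iff h).1 (Lp.coeFn_add k l)] with x hx
    by_cases h0 : h x = 0
    · simp [h0]
    · rw [hx h0, Pi.add_apply, Pi.add_apply, mul_add]
  map_smul' c k := by
    rw [RingHom.id_apply, ← MemLp.toLp_const_smul, MemLp.toLp_eq_toLp_iff]
    filter_upwards [(ae_absDensity_iff h).1 (Lp.coeFn_smul c k)] with x hx
    by_cases h0 : h x = 0
    · simp [h0]
    · rw [hx h0, Pi.smul_apply, Pi.smul_apply, smul_eq_mul, smul_eq_mul, mul_left_comm]
  norm_map' k := by
    simp only [LinearMap.coe_mk, AddHom.coe_mk]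
    rw [Lp.norm_toLp, eLpNorm_mul_eq_absDensity h (Lp.stronglyMeasurable k), ← Lp.norm_def]

theorem coeFn_mulIsometry (h : Lp 𝕜 1 μ) (k : Lp 𝕜 1 (absDensity h)) :
    mulIsometry h k =ᵐ[μ] fun x => h x * k x :=
  (memLp_mul_absDensity h k).coeFn_toLp

theorem mulIsometry_indOne (h : Lp 𝕜 1 μ) {E : Set β} (hE : MeasurableSet E) :
    mulIsometry h (indOne (absDensity h) 𝕜 hE) = bandProj hE h := by
  rw [Lp.ext_iff]
  filter_upwards [coeFn_mulIsometry h (indOne (absDensity h) 𝕜 hE), coeFn_bandProj hE h,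
    (ae_absDensity_iff h).1 (coeFn_indOne (μ := absDensity h) (𝕜 := 𝕜) hE)] with x h1 h2 h3
  rw [h1, h2]
  by_cases h0 : h x = 0
  · by_cases hx : x ∈ E <;> simp [h0, hx]
  · rw [h3 h0]
    by_cases hx : x ∈ E <;> simp [hx]

/-- The preimage is g / h; the convention g / 0 = 0 is harmless, since |h| dμ does not charge the
zeros of h. -/
theorem exists_mulIsometry_eq (h g : Lp 𝕜 1 μ) :
    ∃ k, mulIsometry h k =
      bandProj (Lp.stronglyMeasurable h).measurableSet_support g := by
  have hsm : StronglyMeasurable fun x => g x / h x :=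
    (Lp.stronglyMeasurable g).div (Lp.stronglyMeasurable h)
  have hmem : MemLp (fun x => g x / h x) 1 (absDensity h) := by
    refine ⟨hsm.aestronglyMeasurable, ?_⟩
    rw [← eLpNorm_mul_eq_absDensity h hsm]
    refine lt_of_le_of_lt (eLpNorm_mono fun x => ?_) (Lp.memLp g).2
    by_cases h0 : h x = 0
    · simp [h0]
    · rw [mul_div_cancel₀ _ h0]
  refine ⟨hmem.toLp _, ?_⟩
  rw [Lp.ext_iff]
  filter_upwards [coeFn_mulIsometry h (hmem.toLp _), (ae_absDensity_iff h).1 hmem.coeFn_toLp,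
    coeFn_bandProj (Lp.stronglyMeasurable h).measurableSet_support g] with x h1 h2 h3
  rw [h1, h3]
  by_cases h0 : h x = 0
  · rw [h0, zero_mul, Set.indicator_of_notMem (by simpa using h0)]
  · rw [h2 h0, Set.indicator_of_mem (by simpa using h0), mul_div_cancel₀ _ h0]

/-- Division by `h` as a contraction from `L₁(μ)` to `L₁(|h| dμ)`. -/
theorem exists_div_contraction (h : Lp 𝕜 1 μ) :
    ∃ D : Lp 𝕜 1 μ →L[𝕜] Lp 𝕜 1 (absDensity h),
      (∀ g, ‖D g‖ ≤ ‖g‖) ∧ ∀ k, D (mulIsometry h k) = k := by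
  choose d hd using exists_mulIsometry_eq h
  have hn (g : Lp 𝕜 1 μ) : ‖d g‖ ≤ ‖g‖ := by
    rw [← (mulIsometry h).norm_map, hd]
    exact norm_bandProj_le _ _
  refine ⟨LinearMap.mkContinuous
    { toFun := d
      map_add' := fun f g => (mulIsometry h).injective (by simp only [map_add, hd])
      map_smul' := fun c g => (mulIsometry h).injective (by
        simp only [map_smul, hd, RingHom.id_apply]) } 1 (fun g => by
          rw [one_mul]; exact hn g), hn, fun k => (mulIsometry h).injective ?_⟩
  change mulIsometry h (d (mulIsometry h k)) = _
  rw [hd, bandProj_eq_self_iff]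
  filter_upwards [coeFn_mulIsometry h k] with x hx hx0
  rw [hx, Function.notMem_support.1 hx0, zero_mul]

theorem norm_condExpL1CLM_apply_le {β : Type*} {m m0 : MeasurableSpace β} {μ : Measure β}
    (hm : m ≤ m0) [SigmaFinite (μ.trim hm)] (f : Lp 𝕜 1 μ) : ‖condExpL1CLM 𝕜 hm μ f‖ ≤ ‖f‖ := by
  have := L1.norm_setToL1_le_mul_norm (dominatedFinMeasAdditive_condExpInd 𝕜 hm μ) zero_le_one f
  rwa [one_mul] at this

variable [IsFiniteMeasure ρ]

/-- A disjointness preserving isomorphic embedding of `L₁` has a bounded left inverse. -/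
theorem PreservesDisjoint.exists_leftInverse {T : Lp 𝕜 1 ρ →L[𝕜] Lp 𝕜 1 μ}
    (hT : PreservesDisjoint T) {δ : ℝ} (hδ : 0 < δ) (hbd : ∀ f, δ * ‖f‖ ≤ ‖T f‖) :
    ∃ W : Lp 𝕜 1 μ →L[𝕜] Lp 𝕜 1 ρ, (∀ f, W (T f) = f) ∧ ∀ x, ‖W x‖ ≤ δ⁻¹ * ‖x‖ := by
  have hinj : Function.Injective T := by
    rw [injective_iff_map_eq_zero]
    intro f hf
    have := hbd f
    rw [hf, norm_zero] at this
    exact norm_le_zero_iff.1 (nonpos_of_mul_nonpos_right this hδ)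
  have hclosed : IsClosed (Set.range T) := by
    refine (AntilipschitzWith.isClosedEmbedding (K := (δ⁻¹).toNNReal) ?_
      T.uniformContinuous).isClosed_range
    refine T.antilipschitz_of_bound fun f => ?_
    rw [Real.coe_toNNReal _ (inv_nonneg.2 hδ.le), ← div_eq_inv_mul, le_div_iff₀' hδ]
    exact hbd f
  set one : Lp 𝕜 1 ρ := indOne ρ 𝕜 MeasurableSet.univ with hone
  set h : Lp 𝕜 1 μ := T one with hh
  have hm := bandAlgebra_le T
  obtain ⟨D, hDn, hDJ⟩ := exists_div_contraction h
  have hind {E : Set β} (hE : MeasurableSet E) {A : Set α} (hA : MeasurableSet A)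
      (hEA : ∀ f, bandProj hE (T f) = T (bandProj hA f)) :
      mulIsometry h (indOne (absDensity h) 𝕜 hE) = T (indOne ρ 𝕜 hA) := by
    rw [mulIsometry_indOne, hh, hEA, hone, bandProj_indOne_univ]
  -- For E in `bandAlgebra T` one has h·1_E = T1_A, and the range of T is closed; so h times any
  -- integrable function measurable for that σ-algebra lies in the range.
  have hrange (k : Lp 𝕜 1 (absDensity h)) (hk : AEStronglyMeasurable[bandAlgebra T] k
      (absDensity h)) : mulIsometry h k ∈ Set.range T := by
    refine Lp.induction_stronglyMeasurable hm ENNReal.one_ne_top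
      (fun k => mulIsometry h k ∈ Set.range T) ?_ ?_ ?_ k hk
    · rintro c E hE hμE
      obtain ⟨hE', A, hA, hEA⟩ := id hE
      rw [indicatorConst_eq_smul_indOne, map_smul, hind hE' hA hEA]
      exact ⟨c • indOne ρ 𝕜 hA, map_smul _ _ _⟩
    · rintro f g hf hg - - - ⟨f', hf'⟩ ⟨g', hg'⟩
      exact ⟨f' + g', by rw [map_add, map_add, hf', hg']⟩
    · exact hclosed.preimage ((mulIsometry h).continuous.comp continuous_subtype_val)
  -- Divide by h, take the conditional expectation, multiply by h: this lands in the range of T, and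
  -- W is its preimage.
  have hmem (x : Lp 𝕜 1 μ) :
      ∃ f, T f = mulIsometry h (condExpL1CLM 𝕜 hm (absDensity h) (D x)) :=
    hrange _ (aestronglyMeasurable_condExpL1CLM _)
  choose w hw using hmem
  have hwn (x : Lp 𝕜 1 μ) : ‖w x‖ ≤ δ⁻¹ * ‖x‖ := by
    rw [← div_eq_inv_mul, le_div_iff₀' hδ]
    refine (hbd _).trans ?_
    rw [hw, (mulIsometry h).norm_map]
    exact (norm_condExpL1CLM_apply_le hm _).trans (hDn x)
  let W : Lp 𝕜 1 μ →L[𝕜] Lp 𝕜 1 ρ := LinearMap.mkContinuous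
    { toFun := w
      map_add' := fun f g => hinj (by simp only [map_add, hw])
      map_smul' := fun c g => hinj (by
        simp only [map_smul, hw, RingHom.id_apply, condExpL1CLM_smul]) } δ⁻¹ hwn
  refine ⟨W, fun f => ?_, hwn⟩
  -- T1_A = h·1_E with E in the σ-algebra, so the conditional expectation leaves 1_E unchanged.
  suffices hWT : W ∘L T = ContinuousLinearMap.id 𝕜 _ from congrArg (fun S => S f) hWT
  refine clm_ext_indOne fun A hA => hinj ?_
  obtain ⟨E, hE, hEA⟩ := hT.exists_bandProj_comm hA
  change T (w (T (indOne ρ 𝕜 hA))) = T (indOne ρ 𝕜 hA)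
  have hEm : MeasurableSet[bandAlgebra T] E := ⟨hE, A, hA, hEA⟩
  rw [hw, ← hind hE hA hEA, hDJ, condExpL1CLM_of_aestronglyMeasurable']
  refine AEStronglyMeasurable.congr ?_ (coeFn_indOne hE).symm
  exact (StronglyMeasurable.indicator stronglyMeasurable_const hEm).aestronglyMeasurable

end LeftInverse

/-! ### Isometric copies of L₁ inside bands. -/

section Embedding

open ProbabilityTheory Set in
theorem continuous_cdf_of_nullSingletonClass (η : Measure ℝ) [IsProbabilityMeasure η] [NullSingletonClass η] :
    Continuous (cdf η) := by
  rw [continuous_iff_continuousAt]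
  intro x
  rw [(monotone_cdf η).continuousAt_iff_leftLim_eq_rightLim, (cdf η).rightLim_eq]
  have h := (cdf η).measure_singleton x
  rw [measure_cdf, measure_singleton] at h
  exact le_antisymm ((monotone_cdf η).leftLim_le le_rfl)
    (sub_nonpos.1 (ENNReal.ofReal_eq_zero.1 h.symm))

open ProbabilityTheory Set in
/-- The distribution function of an atomless probability measure on the line transports the
measure to the uniform distribution on `[0,1]`. -/
theorem measurePreserving_cdf (η : Measure ℝ) [IsProbabilityMeasure η] [NullSingletonClass η] :
    MeasurePreserving (cdf η) η unitLebesgue := by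
  have hmeas : Measurable (cdf η) := (monotone_cdf η).measurable
  refine ⟨hmeas, ?_⟩
  have hfin : IsFiniteMeasure (η.map (cdf η)) := Measure.isFiniteMeasure_map _ _
  have hex {s : ℝ} (h0 : 0 < s) (h1 : s < 1) : ∃ t, cdf η t = s :=
    mem_range_of_exists_le_of_exists_ge (continuous_cdf_of_nullSingletonClass η)
      (((tendsto_cdf_atBot η).eventually_le_const h0).exists)
      (((tendsto_cdf_atTop η).eventually_const_le h1).exists)
  refine Measure.ext_of_Iic _ _ fun s => ?_
  rw [Measure.map_apply hmeas measurableSet_Iic, Measure.restrict_apply measurableSet_Iic]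
  rcases lt_or_ge s 0 with hs | hs
  · have h1 : cdf η ⁻¹' Iic s = ∅ := by
      ext x
      simpa using hs.trans_le (cdf_nonneg η x)
    have h2 : Iic s ∩ Icc (0 : ℝ) 1 = ∅ := by
      ext x
      simp only [mem_inter_iff, mem_Iic, mem_Icc, mem_empty_iff_false, iff_false]
      rintro ⟨h3, h4, -⟩
      linarith
    rw [h1, h2, measure_empty, measure_empty]
  rcases le_or_gt 1 s with hs1 | hs1
  · have h1 : cdf η ⁻¹' Iic s = univ := by
      ext x
      simpa using (cdf_le_one η x).trans hs1
    have h2 : Iic s ∩ Icc (0 : ℝ) 1 = Icc 0 1 :=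
      inter_eq_self_of_subset_right fun x hx => hx.2.trans hs1
    rw [h1, h2, measure_univ, Real.volume_Icc, sub_zero, ENNReal.ofReal_one]
  have h2 : Iic s ∩ Icc (0 : ℝ) 1 = Icc 0 s := by
    ext x
    simp only [mem_inter_iff, mem_Iic, mem_Icc]
    constructor
    · rintro ⟨h3, h4, -⟩
      exact ⟨h4, h3⟩
    · rintro ⟨h3, h4⟩
      exact ⟨h4, h3, h4.trans hs1.le⟩
  rw [h2, Real.volume_Icc, sub_zero]
  apply le_antisymm
  -- The distribution function may be flat at level s, so a slightly larger value s' < 1 is used: it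
  -- is attained at some t, and {F ≤ s} lies in `Iic t`.
  · refine ENNReal.le_of_forall_pos_le_add fun ε hε _ => ?_
    obtain ⟨s', hs', hs'1⟩ := exists_between (lt_min hs1 (lt_add_of_pos_right s (NNReal.coe_pos.2 hε)))
    obtain ⟨t, ht⟩ := hex (hs.trans_lt hs') (hs'1.trans_le (min_le_left _ _))
    calc η (cdf η ⁻¹' Iic s) ≤ η (Iic t) := by
          refine measure_mono fun x hx => ?_
          by_contra hxt
          have h3 := monotone_cdf η (not_le.1 hxt).le
          rw [ht] at h3
          exact absurd (h3.trans hx) (not_le.2 hs')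
      _ = ENNReal.ofReal s' := by rw [← ofReal_cdf, ht]
      _ ≤ ENNReal.ofReal (s + ε) :=
          ENNReal.ofReal_le_ofReal (hs'1.le.trans (min_le_right _ _))
      _ ≤ ENNReal.ofReal s + ε := by
          refine ENNReal.ofReal_add_le.trans_eq ?_
          rw [ENNReal.ofReal_coe_nnreal]
  · rcases hs.eq_or_lt with rfl | hs0
    · simp
    obtain ⟨t, ht⟩ := hex hs0 hs1
    rw [← ht, ofReal_cdf]
    exact measure_mono fun x hx => monotone_cdf η hx

variable {𝕜 : Type} [RCLike 𝕜]

/-- Every band of positive measure contains an isometric disjointness preserving copy of `L₁`. -/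
theorem exists_isometry_into_band {A : Set ℝ} (hA : MeasurableSet A) (hA0 : 0 < unitLebesgue A) :
    ∃ U : LOne 𝕜 →ₗᵢ[𝕜] LOne 𝕜, PreservesDisjoint U.toContinuousLinearMap ∧
      ∀ f, bandProj hA (U f) = U f := by
  have hAt : unitLebesgue A ≠ ⊤ := measure_ne_top _ _
  set c : ℝ := unitLebesgue.real A with hc
  have hc0 : 0 < c := ENNReal.toReal_pos hA0.ne' hAt
  have hcA : unitLebesgue A = ENNReal.ofReal c := (ENNReal.ofReal_toReal hAt).symm
  set η : Measure ℝ := (ENNReal.ofReal c⁻¹) • unitLebesgue.restrict A with hη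
  have : IsProbabilityMeasure η := ⟨by
    rw [hη, Measure.smul_apply, Measure.restrict_apply_univ, hcA, smul_eq_mul,
      ← ENNReal.ofReal_mul (inv_nonneg.2 hc0.le), inv_mul_cancel₀ hc0.ne', ENNReal.ofReal_one]⟩
  have : NullSingletonClass η := ⟨fun x => by simp [hη]⟩
  set F := ProbabilityTheory.cdf η
  have hF : MeasurePreserving F η unitLebesgue := measurePreserving_cdf η
  have hae {p : ℝ → Prop} (h : ∀ᵐ y ∂unitLebesgue, p y) :
      ∀ᵐ x ∂unitLebesgue, x ∈ A → p (F x) := by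
    have h1 : ∀ᵐ x ∂η, p (F x) := hF.quasiMeasurePreserving.ae h
    rw [hη, Measure.ae_ennreal_smul_measure_eq (by simpa using hc0), ae_restrict_iff' hA] at h1
    exact h1
  -- The embedding is f ↦ c⁻¹ · 1_A · (f ∘ F); the factor c⁻¹ is the normalisation of η.
  have hnorm (f : LOne 𝕜) : eLpNorm (A.indicator ((c⁻¹ : 𝕜) • (f ∘ F))) 1 unitLebesgue =
      eLpNorm f 1 unitLebesgue := by
    rw [eLpNorm_indicator_eq_eLpNorm_restrict hA, eLpNorm_const_smul,
      ← eLpNorm_comp_measurePreserving (Lp.aestronglyMeasurable f) hF, hη,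
      eLpNorm_one_smul_measure]
    congr 1
    rw [← ofReal_norm, norm_inv, RCLike.norm_ofReal, abs_of_pos hc0]
  have hmem (f : LOne 𝕜) : MemLp (A.indicator ((c⁻¹ : 𝕜) • (f ∘ F))) 1 unitLebesgue := by
    refine ⟨(StronglyMeasurable.indicator (((Lp.stronglyMeasurable f).comp_measurable
      hF.measurable).const_smul _) hA).aestronglyMeasurable, ?_⟩
    rw [hnorm]
    exact (Lp.memLp f).2
  let U : LOne 𝕜 →ₗᵢ[𝕜] LOne 𝕜 :=
    { toFun := fun f => (hmem f).toLp _
      map_add' := fun f g => by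
        rw [← MemLp.toLp_add, MemLp.toLp_eq_toLp_iff]
        filter_upwards [hae (Lp.coeFn_add f g)] with x hx
        by_cases hxA : x ∈ A
        · simp only [Pi.add_apply, Set.indicator_of_mem hxA, Pi.smul_apply, Function.comp_apply,
            hx hxA, smul_add]
        · simp only [Pi.add_apply, Set.indicator_of_notMem hxA, add_zero]
      map_smul' := fun a f => by
        rw [RingHom.id_apply, ← MemLp.toLp_const_smul, MemLp.toLp_eq_toLp_iff]
        filter_upwards [hae (Lp.coeFn_smul a f)] with x hx
        by_cases hxA : x ∈ A
        · simp only [Set.indicator_of_mem hxA, Pi.smul_apply, Function.comp_apply, hx hxA]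
          rw [smul_comm]
        · simp only [Pi.smul_apply, Set.indicator_of_notMem hxA, smul_zero]
      norm_map' := fun f => by
        simp only [LinearMap.coe_mk, AddHom.coe_mk]
        rw [Lp.norm_toLp, hnorm, ← Lp.norm_def] }
  have hU (f : LOne 𝕜) : U f =ᵐ[unitLebesgue] A.indicator ((c⁻¹ : 𝕜) • (f ∘ F)) :=
    (hmem f).coeFn_toLp
  refine ⟨U, fun f g hfg => ?_, fun f => ?_⟩
  · rw [LinearIsometry.coe_toContinuousLinearMap]
    filter_upwards [hU f, hU g, hae hfg] with x h1 h2 h3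
    rw [h1, h2]
    by_cases hxA : x ∈ A
    · refine (h3 hxA).imp (fun h => ?_) fun h => ?_ <;> simp [h]
    · exact Or.inl (Set.indicator_of_notMem hxA _)
  · rw [bandProj_eq_self_iff]
    filter_upwards [hU f] with x hx hxA
    rw [hx, Set.indicator_of_notMem hxA]

end Embedding

/-! ### Bands on which the operator is bounded below. -/

section BoundedBelow

variable {α β : Type*} [MeasurableSpace α] [MeasurableSpace β] {ρ : Measure α} {μ : Measure β}
  {𝕜 : Type*} [RCLike 𝕜] [IsFiniteMeasure ρ]

theorem AEDisjointFun.enorm_add {f g : Lp 𝕜 1 μ} (h : AEDisjointFun f g) :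
    ‖f + g‖ₑ = ‖f‖ₑ + ‖g‖ₑ := by
  rw [← ofReal_norm, ← ofReal_norm, ← ofReal_norm, h.norm_add,
    ENNReal.ofReal_add (norm_nonneg f) (norm_nonneg g)]

theorem indOne_union {A B : Set α} (hA : MeasurableSet A) (hB : MeasurableSet B)
    (hAB : Disjoint A B) : indOne ρ 𝕜 (hA.union hB) = indOne ρ 𝕜 hA + indOne ρ 𝕜 hB := by
  rw [← bandProj_indOne_univ (hA.union hB), bandProj_union hA hB,
    bandProj_bandProj_of_disjoint hA hB hAB, sub_zero, bandProj_indOne_univ, bandProj_indOne_univ]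

theorem aeDisjointFun_indOne {A B : Set α} (hA : MeasurableSet A) (hB : MeasurableSet B)
    (hAB : Disjoint A B) : AEDisjointFun (indOne ρ 𝕜 hA) (indOne ρ 𝕜 hB) := by
  rw [← bandProj_indOne_univ hA, ← bandProj_indOne_univ hB]
  exact aeDisjointFun_bandProj hA hB hAB _ _

theorem PreservesDisjoint.enorm_indOne_iUnion {T : Lp 𝕜 1 ρ →L[𝕜] Lp 𝕜 1 μ}
    (hT : PreservesDisjoint T) (A : ℕ → Set α) (hA : ∀ i, MeasurableSet (A i))
    (hd : Pairwise (Function.onFun Disjoint A)) :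
    ‖T (indOne ρ 𝕜 (MeasurableSet.iUnion hA))‖ₑ = ∑' i, ‖T (indOne ρ 𝕜 (hA i))‖ₑ := by
  have hAa (n : ℕ) : MeasurableSet (Set.accumulate A n) :=
    MeasurableSet.iUnion fun i => MeasurableSet.iUnion fun _ => hA i
  have hfin (n : ℕ) : ‖T (indOne ρ 𝕜 (hAa n))‖ₑ =
      ∑ i ∈ Finset.range (n + 1), ‖T (indOne ρ 𝕜 (hA i))‖ₑ := by
    induction n with
    | zero => simp
    | succ n ih =>
      have hdis : Disjoint (Set.accumulate A n) (A (n + 1)) :=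
        Set.disjoint_accumulate hd n.lt_succ_self
      rw [Finset.sum_range_succ, ← ih]
      simp only [Set.accumulate_succ]
      rw [indOne_union (hAa n) (hA (n + 1)) hdis, map_add,
        (hT _ _ (aeDisjointFun_indOne (hAa n) (hA (n + 1)) hdis)).enorm_add]
  have h1 := (continuous_enorm.comp T.continuous).tendsto _ |>.comp
    (tendsto_indOne_iUnion (μ := ρ) (𝕜 := 𝕜) hAa Set.monotone_accumulate)
  simp only [Set.iUnion_accumulate] at h1
  have h2 := (ENNReal.tendsto_nat_tsum fun i => ‖T (indOne ρ 𝕜 (hA i))‖ₑ).comp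
    (Filter.tendsto_add_atTop_nat 1)
  exact tendsto_nhds_unique h1 (h2.congr fun n => (hfin n).symm)

theorem indOne_eq_zero {A : Set α} (hA : MeasurableSet A) (h : ρ A = 0) : indOne ρ 𝕜 hA = 0 := by
  rw [← norm_eq_zero, norm_indOne, measureReal_def, h, ENNReal.toReal_zero]

/-- A nonzero disjointness preserving operator is bounded below on a nonzero band. -/
theorem PreservesDisjoint.exists_boundedBelow {T : Lp 𝕜 1 ρ →L[𝕜] Lp 𝕜 1 μ}
    (hT : PreservesDisjoint T) (hT0 : T ≠ 0) :
    ∃ (A : Set α) (hA : MeasurableSet A) (δ : ℝ), 0 < ρ A ∧ 0 < δ ∧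
      ∀ f, δ * ‖bandProj hA f‖ ≤ ‖T (bandProj hA f)‖ := by
  let ν : Measure α := Measure.ofMeasurable (fun A hA => ‖T (indOne ρ 𝕜 hA)‖ₑ)
    (by rw [indOne_eq_zero _ measure_empty, map_zero, enorm_zero]) hT.enorm_indOne_iUnion
  have hν {A : Set α} (hA : MeasurableSet A) : ν A = ‖T (indOne ρ 𝕜 hA)‖ₑ :=
    Measure.ofMeasurable_apply A hA
  have hfin : IsFiniteMeasure ν := ⟨by rw [hν MeasurableSet.univ]; exact enorm_lt_top⟩
  have hac : ν ≪ ρ := Measure.AbsolutelyContinuous.mk fun A hA h => by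
    rw [hν hA, indOne_eq_zero hA h, map_zero, enorm_zero]
  -- If ν were singular to ρ as well as absolutely continuous, it would vanish, and T with it.
  have hns : ¬ ν ⟂ₘ ρ := by
    intro hs
    have h0 := Measure.eq_zero_of_absolutelyContinuous_of_mutuallySingular hac hs
    refine hT0 (clm_ext_indOne fun A hA => ?_)
    have h1 := hν hA
    rw [h0, Measure.coe_zero, Pi.zero_apply] at h1
    exact enorm_eq_zero.1 h1.symm
  obtain ⟨ε, hε, E, hE, hE0, h⟩ := Measure.exists_positive_of_not_mutuallySingular ν ρ hns
  refine ⟨E, hE, ε, hE0, hε, hT.le_norm_of_le_norm_indOne hE fun B hB => ?_⟩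
  have h1 := h B hB
  rw [Set.inter_comm, hν (hE.inter hB)] at h1
  have h2 := ENNReal.toReal_mono enorm_ne_top h1
  rwa [ENNReal.toReal_mul, toReal_enorm, ENNReal.coe_toReal] at h2

end BoundedBelow

/-! ### The operator-theoretic criterion. -/

section Subspace

variable {𝕜 E : Type} [RCLike 𝕜] [NormedAddCommGroup E] [NormedSpace 𝕜 E]

theorem exists_subspace_of_leftInverse [Nontrivial E] (T : E →L[𝕜] E) (U : E →ₗᵢ[𝕜] E)
    (V W : E →L[𝕜] E) (hVU : ∀ f, V (U f) = f) (hWU : ∀ f, W (U f) = 0)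
    (hWTU : ∀ f, W (T (U f)) = f) :
    ∃ Y : Submodule 𝕜 E,
      Nonempty (Y ≃ₗᵢ[𝕜] E) ∧
      0 < subspaceDist Y (Y.map (T : E →ₗ[𝕜] E)) ∧
      (Y ⊔ Y.map (T : E →ₗ[𝕜] E)).ClosedComplemented := by
  refine ⟨LinearMap.range U.toLinearMap, ⟨U.equivRange.symm⟩, ?_, ?_⟩
  -- Q recovers f from Uf - TUg, so ‖Uf - TUg‖ is at least ‖f‖ / (‖Q‖ + 1); the added 1 avoids
  -- proving Q ≠ 0.
  · let Q : E →L[𝕜] E := V ∘L (ContinuousLinearMap.id 𝕜 E - T ∘L U.toContinuousLinearMap ∘L W)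
    have hQ (f g : E) : Q (U f - T (U g)) = f := by
      simp only [Q, ContinuousLinearMap.comp_apply, sub_apply,
        ContinuousLinearMap.id_apply, LinearIsometry.coe_toContinuousLinearMap, map_sub, hWU, hWTU,
        hVU, map_zero]
      abel
    have hpos : 0 < (‖Q‖ + 1)⁻¹ := by positivity
    refine hpos.trans_le (le_csInf ?_ ?_)
    · obtain ⟨x, hx⟩ := NormedSpace.exists_lt_norm 𝕜 E 0
      refine ⟨_, U ((‖x‖⁻¹ : 𝕜) • x), ⟨_, rfl⟩, ?_, 0, zero_mem _, rfl⟩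
      rw [U.norm_map, norm_smul, norm_inv, RCLike.norm_ofReal, abs_norm, inv_mul_cancel₀ hx.ne']
    · rintro r ⟨_, ⟨f, rfl⟩, hf, _, ⟨_, ⟨g, rfl⟩, rfl⟩, rfl⟩
      have hf' : ‖f‖ = 1 := by rw [← U.norm_map f]; exact hf
      rw [inv_le_iff_one_le_mul₀ (by positivity)]
      calc 1 = ‖Q (U f - T (U g))‖ := by rw [hQ, hf']
        _ ≤ ‖Q‖ * ‖U f - T (U g)‖ := Q.le_opNorm _
        _ ≤ (‖Q‖ + 1) * ‖U f - T (U g)‖ := by gcongr; linarith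
        _ = _ := mul_comm _ _
  -- TUW extracts the TY component; UV applied to the remainder gives the Y component.
  · let P : E →L[𝕜] E := U.toContinuousLinearMap ∘L V ∘L
      (ContinuousLinearMap.id 𝕜 E - T ∘L U.toContinuousLinearMap ∘L W) +
      T ∘L U.toContinuousLinearMap ∘L W
    have hP (x : E) : P x = U (V (x - T (U (W x)))) + T (U (W x)) := rfl
    refine ⟨P.codRestrict _ fun x => ?_, fun x => Subtype.ext ?_⟩
    · rw [hP]
      exact Submodule.add_mem_sup ⟨_, rfl⟩ ⟨_, ⟨W x, rfl⟩, rfl⟩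
    · rw [ContinuousLinearMap.coe_codRestrict_apply]
      obtain ⟨_, ⟨f, rfl⟩, _, ⟨_, ⟨g, rfl⟩, rfl⟩, hx⟩ := Submodule.mem_sup.1 x.2
      rw [← hx]
      change P (U f + T (U g)) = U f + T (U g)
      rw [hP, map_add, hWU, hWTU, zero_add, add_sub_cancel_right, hVU]

end Subspace

/-! ### Non-local operators, multiplication operators, and the theorem. -/

section Main

variable {𝕜 : Type} [RCLike 𝕜]

/-- Contractivity keeps the error ε from being inflated in the multiplication case. -/
theorem exists_contractive_leftInverse {U : LOne 𝕜 →ₗᵢ[𝕜] LOne 𝕜}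
    (hU : PreservesDisjoint U.toContinuousLinearMap) :
    ∃ V : LOne 𝕜 →L[𝕜] LOne 𝕜, (∀ f, V (U f) = f) ∧ ∀ x, ‖V x‖ ≤ ‖x‖ := by
  obtain ⟨V, hV, hVn⟩ := hU.exists_leftInverse one_pos fun f => by
    rw [one_mul, LinearIsometry.coe_toContinuousLinearMap, U.norm_map]
  refine ⟨V, hV, fun x => ?_⟩
  simpa using hVn x

theorem PreservesDisjoint.exists_subspace_of_not_local {T : LOne 𝕜 →L[𝕜] LOne 𝕜}
    (hT : PreservesDisjoint T) [Nontrivial (LOne 𝕜)] {A : Set ℝ} (hA : MeasurableSet A)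
    (h : bandProj hA.compl ∘L T ∘L bandProj hA ≠ 0) :
    ∃ Y : Submodule 𝕜 (LOne 𝕜),
      Nonempty (Y ≃ₗᵢ[𝕜] LOne 𝕜) ∧
      0 < subspaceDist Y (Y.map (T : LOne 𝕜 →ₗ[𝕜] LOne 𝕜)) ∧
      (Y ⊔ Y.map (T : LOne 𝕜 →ₗ[𝕜] LOne 𝕜)).ClosedComplemented := by
  have hS : PreservesDisjoint (bandProj hA.compl ∘L T ∘L bandProj hA) :=
    (preservesDisjoint_bandProj _).comp (hT.comp (preservesDisjoint_bandProj _))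
  obtain ⟨B, hB, δ, hB0, hδ, hbd⟩ := hS.exists_boundedBelow h
  obtain ⟨U, hUd, hUB⟩ := exists_isometry_into_band (𝕜 := 𝕜) hB hB0
  -- P_{Aᶜ}Uf lies in L₁(B), where S is bounded below, yet S kills it; so it is zero.
  have hUc (f : LOne 𝕜) : bandProj hA.compl (U f) = 0 := by
    have h1 := hbd (bandProj hA.compl (U f))
    rw [bandProj_comm hB, hUB] at h1
    simp only [ContinuousLinearMap.comp_apply] at h1
    rw [bandProj_bandProj_compl, map_zero, map_zero, norm_zero] at h1
    exact norm_le_zero_iff.1 (nonpos_of_mul_nonpos_right h1 hδ)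
  have hUA (f : LOne 𝕜) : bandProj hA (U f) = U f := by
    rw [← sub_eq_zero, ← neg_sub, ← bandProj_compl, hUc, neg_zero]
  obtain ⟨V, hV, -⟩ := exists_contractive_leftInverse hUd
  obtain ⟨W, hW, -⟩ := (hS.comp hUd).exists_leftInverse hδ fun f => by
    have h1 := hbd (U f)
    rw [hUB, U.norm_map] at h1
    exact h1
  refine exists_subspace_of_leftInverse T U V (W ∘L bandProj hA.compl) hV (fun f => ?_)
    fun f => ?_
  · rw [ContinuousLinearMap.comp_apply, hUc, map_zero]
  · have h1 := hW f
    simp only [ContinuousLinearMap.comp_apply, LinearIsometry.coe_toContinuousLinearMap, hUA] at h1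
    exact h1

/-- The support of the distribution of h has full measure; were it a single point, h would be a.e.
constant. -/
theorem exists_ne_mem_support_map {α E : Type*} [MeasurableSpace α] {μ : Measure α} [NeZero μ]
    [TopologicalSpace E] [HereditarilyLindelofSpace E] [MeasurableSpace E]
    {h : α → E} (hm : Measurable h) (hne : ∀ c, ¬ h =ᵐ[μ] fun _ => c) :
    ∃ a ∈ (μ.map h).support, ∃ b ∈ (μ.map h).support, a ≠ b := by
  have hae : ∀ᵐ x ∂μ, h x ∈ (μ.map h).support :=
    ae_of_ae_map hm.aemeasurable Measure.support_mem_ae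
  obtain ⟨x, hx⟩ := hae.exists
  by_contra! hcon
  refine hne (h x) ?_
  filter_upwards [hae] with y hy
  exact (hcon _ hx _ hy).symm

/-- Commuting with bands forces T1_B = 1_B · T1, and T1 is within ε of a on A; testing on indicators
suffices. -/
theorem norm_comp_bandProj_le {T : LOne 𝕜 →L[𝕜] LOne 𝕜} {A : Set ℝ} (hA : MeasurableSet A)
    (hTc : ∀ {B : Set ℝ} (hB : MeasurableSet B) f, bandProj hB (T f) = T (bandProj hB f))
    {a : 𝕜} {ε : ℝ} (hε : 0 ≤ ε) (hAε : ∀ x ∈ A, ‖T (indOne unitLebesgue 𝕜 MeasurableSet.univ) x - a‖ ≤ ε)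
    (f : LOne 𝕜) : ‖T (bandProj hA f) - a • bandProj hA f‖ ≤ ε * ‖f‖ := by
  refine norm_le_of_norm_indOne_le
    (S := (T - a • ContinuousLinearMap.id 𝕜 (LOne 𝕜)) ∘L bandProj hA) (fun B hB => ?_) f
  rw [← norm_indOne (μ := unitLebesgue) (𝕜 := 𝕜) hB]
  refine Lp.norm_le_mul_norm_of_ae_le_mul ?_
  set one := indOne unitLebesgue 𝕜 MeasurableSet.univ with hone
  have h1 : ((T - a • ContinuousLinearMap.id 𝕜 (LOne 𝕜)) ∘L bandProj hA) (indOne _ 𝕜 hB) =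
      bandProj hA (bandProj hB (T one - a • one)) := by
    rw [← bandProj_indOne_univ hB, ← hone, map_sub, map_sub, hTc hB, hTc hA, map_smul, map_smul]
    rfl
  rw [h1]
  filter_upwards [coeFn_bandProj hA (bandProj hB (T one - a • one)),
    coeFn_bandProj hB (T one - a • one), coeFn_indOne (μ := unitLebesgue) (𝕜 := 𝕜) hB,
    Lp.coeFn_sub (T one) (a • one), Lp.coeFn_smul a one,
    coeFn_indOne (μ := unitLebesgue) (𝕜 := 𝕜) MeasurableSet.univ] with x h2 h3 h4 h5 h6 h7
  rw [h2, h4]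
  by_cases hxB : x ∈ B
  · by_cases hxA : x ∈ A
    · rw [Set.indicator_of_mem hxA, h3, Set.indicator_of_mem hxB, h5, Pi.sub_apply, h6,
        Pi.smul_apply, h7]
      simpa [hxB] using hAε x hxA
    · rw [Set.indicator_of_notMem hxA, norm_zero]
      positivity
  · rw [Set.indicator_of_notMem hxB, norm_zero, mul_zero, norm_le_zero_iff]
    by_cases hxA : x ∈ A
    · rw [Set.indicator_of_mem hxA, h3, Set.indicator_of_notMem hxB]
    · rw [Set.indicator_of_notMem hxA]

theorem exists_subspace_of_local [Nontrivial (LOne 𝕜)] {T : LOne 𝕜 →L[𝕜] LOne 𝕜}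
    (hTI : ∀ c : 𝕜, T ≠ c • ContinuousLinearMap.id 𝕜 (LOne 𝕜))
    (hTc : ∀ {B : Set ℝ} (hB : MeasurableSet B) f, bandProj hB (T f) = T (bandProj hB f)) :
    ∃ Y : Submodule 𝕜 (LOne 𝕜),
      Nonempty (Y ≃ₗᵢ[𝕜] LOne 𝕜) ∧
      0 < subspaceDist Y (Y.map (T : LOne 𝕜 →ₗ[𝕜] LOne 𝕜)) ∧
      (Y ⊔ Y.map (T : LOne 𝕜 →ₗ[𝕜] LOne 𝕜)).ClosedComplemented := by
  set one := indOne unitLebesgue 𝕜 MeasurableSet.univ with hone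
  have hm : Measurable (T one) := (Lp.stronglyMeasurable (T one)).measurable
  have : NeZero unitLebesgue := ⟨by simp [unitLebesgue]⟩
  obtain ⟨a, ha, b, hb, hab⟩ := exists_ne_mem_support_map (μ := unitLebesgue) hm (by
    intro c hc
    refine hTI c (clm_ext_indOne fun B hB => ?_)
    have h1 : T one = c • one := by
      rw [Lp.ext_iff]
      filter_upwards [hc, Lp.coeFn_smul c one,
        coeFn_indOne (μ := unitLebesgue) (𝕜 := 𝕜) MeasurableSet.univ] with x h1 h2 h3
      rw [h1, h2, Pi.smul_apply, h3]
      simp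
    rw [← bandProj_indOne_univ hB, ← hTc hB, ← hone, h1, map_smul]
    rfl)
  -- A third makes the two balls disjoint and leaves a total relative error 2ε / ‖a - b‖ = 2/3 < 1.
  set ε := ‖a - b‖ / 3 with hε
  have hn0 : 0 < ‖a - b‖ := norm_pos_iff.2 (sub_ne_zero.2 hab)
  have hε0 : 0 < ε := by positivity
  set A := T one ⁻¹' Metric.ball a ε with hAdef
  set B := T one ⁻¹' Metric.ball b ε with hBdef
  have hA : MeasurableSet A := hm measurableSet_ball
  have hB : MeasurableSet B := hm measurableSet_ball
  have hpos {c : 𝕜} (hc : c ∈ (unitLebesgue.map (T one)).support) :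
      0 < unitLebesgue (T one ⁻¹' Metric.ball c ε) := by
    rw [← Measure.map_apply hm measurableSet_ball]
    exact (Measure.mem_support_iff_forall c).1 hc _ (Metric.ball_mem_nhds c hε0)
  have hAB : Disjoint A B := by
    refine Disjoint.preimage _ (Metric.ball_disjoint_ball ?_)
    rw [dist_eq_norm, hε]
    linarith
  obtain ⟨U₁, hU₁d, hU₁⟩ := exists_isometry_into_band (𝕜 := 𝕜) hA (hpos ha)
  obtain ⟨U₂, hU₂d, hU₂⟩ := exists_isometry_into_band (𝕜 := 𝕜) hB (hpos hb)
  obtain ⟨V₁, hV₁, hV₁n⟩ := exists_contractive_leftInverse hU₁d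
  obtain ⟨V₂, hV₂, hV₂n⟩ := exists_contractive_leftInverse hU₂d
  have h12 (f : LOne 𝕜) : bandProj hA (U₂ f) = 0 := by
    rw [← hU₂, bandProj_bandProj_of_disjoint hA hB hAB]
  have h21 (f : LOne 𝕜) : bandProj hB (U₁ f) = 0 := by
    rw [← hU₁, bandProj_bandProj_of_disjoint hB hA hAB.symm]
  let U : LOne 𝕜 →ₗᵢ[𝕜] LOne 𝕜 :=
    { toLinearMap := (2⁻¹ : 𝕜) • (U₁.toLinearMap + U₂.toLinearMap)
      norm_map' := fun f => by
        have hd : AEDisjointFun (U₁ f) (U₂ f) := by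
          rw [← hU₁, ← hU₂]
          exact aeDisjointFun_bandProj hA hB hAB _ _
        change ‖(2⁻¹ : 𝕜) • (U₁ f + U₂ f)‖ = ‖f‖
        rw [norm_smul, hd.norm_add, U₁.norm_map, U₂.norm_map, norm_inv, RCLike.norm_ofNat]
        ring }
  have hU (f : LOne 𝕜) : U f = (2⁻¹ : 𝕜) • (U₁ f + U₂ f) := rfl
  let D₁ : LOne 𝕜 →L[𝕜] LOne 𝕜 := (2 : 𝕜) • (V₁ ∘L bandProj hA)
  let D₂ : LOne 𝕜 →L[𝕜] LOne 𝕜 := (2 : 𝕜) • (V₂ ∘L bandProj hB)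
  have hD₁ (x : LOne 𝕜) : D₁ x = (2 : 𝕜) • V₁ (bandProj hA x) := rfl
  have hD₂ (x : LOne 𝕜) : D₂ x = (2 : 𝕜) • V₂ (bandProj hB x) := rfl
  have hD₁U (f : LOne 𝕜) : D₁ (U f) = f := by
    rw [hD₁, hU, map_smul, map_smul, smul_inv_smul₀ two_ne_zero, map_add, hU₁, h12, add_zero, hV₁]
  have hD₂U (f : LOne 𝕜) : D₂ (U f) = f := by
    rw [hD₂, hU, map_smul, map_smul, smul_inv_smul₀ two_ne_zero, map_add, hU₂, h21, zero_add, hV₂]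
  have hD₁T (f : LOne 𝕜) : D₁ (T (U f)) = V₁ (T (U₁ f)) := by
    rw [hD₁, hTc, hU, map_smul, map_smul, map_smul, smul_inv_smul₀ two_ne_zero, map_add, hU₁, h12,
      add_zero]
  have hD₂T (f : LOne 𝕜) : D₂ (T (U f)) = V₂ (T (U₂ f)) := by
    rw [hD₂, hTc, hU, map_smul, map_smul, map_smul, smul_inv_smul₀ two_ne_zero, map_add, hU₂, h21,
      zero_add]
  -- D₁ and D₂ are both left inverses of U, so D₁ - D₂ kills U; on TU they see multipliers near a
  -- and near b, which makes N close to the identity.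
  let N : LOne 𝕜 →L[𝕜] LOne 𝕜 := (a - b)⁻¹ • ((D₁ - D₂) ∘L T ∘L U.toContinuousLinearMap)
  have hN (f : LOne 𝕜) : N f = (a - b)⁻¹ • (V₁ (T (U₁ f)) - V₂ (T (U₂ f))) := by
    rw [← hD₁T, ← hD₂T]
    rfl
  have hclose (f : LOne 𝕜) : ‖f - N f‖ ≤ 2 / 3 * ‖f‖ := by
    have h1 : ‖V₁ (T (U₁ f)) - a • f‖ ≤ ε * ‖f‖ := by
      have h2 := norm_comp_bandProj_le (a := a) (ε := ε) hA hTc hε0.le (fun x hx => by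
        rw [← dist_eq_norm]; exact (Metric.mem_ball.1 hx).le) (U₁ f)
      rw [hU₁, U₁.norm_map] at h2
      have h3 : V₁ (T (U₁ f)) - a • f = V₁ (T (U₁ f) - a • U₁ f) := by
        rw [map_sub, map_smul, hV₁]
      rw [h3]
      exact (hV₁n _).trans h2
    have h1' : ‖V₂ (T (U₂ f)) - b • f‖ ≤ ε * ‖f‖ := by
      have h2 := norm_comp_bandProj_le (a := b) (ε := ε) hB hTc hε0.le (fun x hx => by
        rw [← dist_eq_norm]; exact (Metric.mem_ball.1 hx).le) (U₂ f)
      rw [hU₂, U₂.norm_map] at h2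
      have h3 : V₂ (T (U₂ f)) - b • f = V₂ (T (U₂ f) - b • U₂ f) := by
        rw [map_sub, map_smul, hV₂]
      rw [h3]
      exact (hV₂n _).trans h2
    have h4 : f - N f = (a - b)⁻¹ • ((V₂ (T (U₂ f)) - b • f) - (V₁ (T (U₁ f)) - a • f)) := by
      have h5 : f = (a - b)⁻¹ • (a • f - b • f) := by
        rw [← sub_smul, inv_smul_smul₀ (sub_ne_zero.2 hab)]
      rw [hN]
      nth_rewrite 1 [h5]
      rw [← smul_sub]
      congr 1
      abel
    rw [h4, norm_smul, norm_inv]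
    calc ‖a - b‖⁻¹ * ‖(V₂ (T (U₂ f)) - b • f) - (V₁ (T (U₁ f)) - a • f)‖
        ≤ ‖a - b‖⁻¹ * (ε * ‖f‖ + ε * ‖f‖) := by
          gcongr
          exact (norm_sub_le _ _).trans (add_le_add h1' h1)
      _ = 2 / 3 * ‖f‖ := by
          rw [hε]
          field_simp
          ring
  have hnorm : ‖1 - N‖ < 1 := by
    refine lt_of_le_of_lt (ContinuousLinearMap.opNorm_le_bound _ (by norm_num) hclose) ?_
    norm_num
  let u := Units.oneSub (1 - N) hnorm
  have hu (f : LOne 𝕜) : (↑u⁻¹ : LOne 𝕜 →L[𝕜] LOne 𝕜) (N f) = f := by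
    have h1 : (↑u : LOne 𝕜 →L[𝕜] LOne 𝕜) = N := by
      rw [Units.val_oneSub, sub_sub_cancel]
    have h2 := congrArg (fun S : LOne 𝕜 →L[𝕜] LOne 𝕜 => S f) u.inv_mul
    rw [h1] at h2
    exact h2
  refine exists_subspace_of_leftInverse T U D₁
    ((↑u⁻¹ : LOne 𝕜 →L[𝕜] LOne 𝕜) ∘L ((a - b)⁻¹ • (D₁ - D₂))) hD₁U (fun f => ?_) fun f => ?_
  · simp only [ContinuousLinearMap.comp_apply, smul_apply,
      sub_apply, hD₁U, hD₂U, sub_self, smul_zero, map_zero]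
  · exact hu f

theorem mainTheorem7 (𝕜 : Type) [RCLike 𝕜] (T : LOne 𝕜 →L[𝕜] LOne 𝕜)
    (hatom : IsAtomOperator T) (hT0 : T ≠ 0)
    (hTI : ∀ c : 𝕜, T ≠ c • ContinuousLinearMap.id 𝕜 (LOne 𝕜)) :
    ∃ Y : Submodule 𝕜 (LOne 𝕜),
      Nonempty (Y ≃ₗᵢ[𝕜] LOne 𝕜) ∧
      0 < subspaceDist Y (Y.map (T : LOne 𝕜 →ₗ[𝕜] LOne 𝕜)) ∧
      (Y ⊔ Y.map (T : LOne 𝕜 →ₗ[𝕜] LOne 𝕜)).ClosedComplemented := by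
  have hT : PreservesDisjoint T := fun f g h => by
    rw [aeDisjointFun_iff_measure_support_inter] at h ⊢
    exact hatom f g h
  have : Nontrivial (LOne 𝕜) := by
    by_contra hcon
    rw [not_nontrivial_iff_subsingleton] at hcon
    exact hT0 (ContinuousLinearMap.ext fun f => Subsingleton.elim _ _)
  by_cases hloc : ∃ (A : Set ℝ) (hA : MeasurableSet A),
      bandProj hA.compl ∘L T ∘L bandProj hA ≠ 0
  · obtain ⟨A, hA, h⟩ := hloc
    exact hT.exists_subspace_of_not_local hA h
  · push Not at hloc
    have h0 {A : Set ℝ} (hA : MeasurableSet A) (f : LOne 𝕜) :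
        bandProj hA.compl (T (bandProj hA f)) = 0 :=
      congrArg (fun S : LOne 𝕜 →L[𝕜] LOne 𝕜 => S f) (hloc A hA)
    -- Vanishing of P_{Aᶜ} T P_A for both A and Aᶜ means that T maps each of the two complementary
    -- bands into itself, hence commutes with P_A.
    refine exists_subspace_of_local hTI fun {A} hA f => ?_
    have h1 : bandProj hA (T (bandProj hA f)) = T (bandProj hA f) := by
      have := h0 hA f
      rw [bandProj_compl hA, sub_eq_zero] at this
      exact this.symm
    have h2 : bandProj hA (T (bandProj hA.compl f)) = 0 := by
      have := h0 hA.compl f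
      rw [bandProj_compl hA.compl, sub_eq_zero] at this
      rw [this, bandProj_bandProj_compl]
    conv_lhs => rw [← bandProj_add_compl hA f, map_add, map_add, h1, h2, add_zero]

end Main
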